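/- For a positive integer $n$, let $M_n(\mathbb{R})$ be the space of real $n\times n$ matrices, let $\mathrm{GL}_n(\mathbb{R})\subset M_n(\mathbb{R})$ be the set of invertible matrices, and let $$K^* = \{A\in M_n(\mathbb{R}) : \text{there exists } X\in M_n(\mathbb{R}) \text{ with } e^X = A\}$$ be the set of real matrices that admit a real logarithm, where $e^X=\sum_{k=0}^\infty X^k/k!$. Let $\varphi : M_n(\mathbb{R})\to M_n(\mathbb{R})$ be a bijective linear map such that $\varphi(K^*)=K^*$. Then $\varphi(\mathrm{GL}_n(\mathbb{R}))=\mathrm{GL}_n(\mathbb{R})$. -/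

import Mathlib

/-- `Kstar n` is the set of real `n × n` matrices that admit a real logarithm, i.e. that are
of the form `exp X` for some real `n × n` matrix `X` (`NormedSpace.exp` is the matrix
exponential `∑ X ^ k / k!`). -/
def Kstar (n : ℕ) : Set (Matrix (Fin n) (Fin n) ℝ) :=
  {A | ∃ X : Matrix (Fin n) (Fin n) ℝ, NormedSpace.exp X = A}

/-- `GLset n` is `GL_n(ℝ)` viewed as the subset of invertible matrices in `M_n(ℝ)`. -/
def GLset (n : ℕ) : Set (Matrix (Fin n) (Fin n) ℝ) :=
  {A | IsUnit A}

/-! ### Logarithms in a real Banach algebra -/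

section Logarithm

open NormedSpace Set MeasureTheory

variable {𝔸 : Type*} [NormedRing 𝔸] [NormedAlgebra ℝ 𝔸] [CompleteSpace 𝔸]

/-! Two facts about real logarithms suffice: a matrix with no eigenvalue in `(-∞, 0]` has one, and a
matrix `A` that has one satisfies `det A ≠ 0` and `det (A + x) ≥ 0` for `x ≥ 0`.

Let `A` be singular with no negative eigenvalue. Then `A + ε` lies in `Kstar` for `ε > 0`, so `e A`
is a limit of points of `Kstar` but is not in it. Hence `det (e A + x)` is nonnegative for `x ≥ 0`
and vanishes somewhere: `e A` is singular or has a multiple eigenvalue, that is, `det * disc`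
vanishes at `e A`, with `disc` the discriminant up to sign (`charpolyDerivDet`). Polynomial
identities along curves extend this to every singular `A`.

The singular matrices behave like an irreducible variety: any two are joined by a polynomial curve
of singular matrices. Since `disc ∘ e` is not identically zero on them, `det ∘ e` is. The same
argument for `e.symm` gives the converse. -/

theorem Commute.intervalIntegral_right {x : 𝔸} {g : ℝ → 𝔸} {a b : ℝ}
    (hg : IntervalIntegrable g volume a b) (h : ∀ s, Commute x (g s)) :
    Commute x (∫ s in a..b, g s) := by
  have key := (ContinuousLinearMap.mul ℝ 𝔸 x
    - (ContinuousLinearMap.mul ℝ 𝔸).flip x).intervalIntegral_comp_comm hg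
  have h0 : ∀ s, (ContinuousLinearMap.mul ℝ 𝔸 x
      - (ContinuousLinearMap.mul ℝ 𝔸).flip x) (g s) = 0 := fun s => by
    simp [(h s).eq]
  simp only [h0, intervalIntegral.integral_zero] at key
  have : x * (∫ s in a..b, g s) - (∫ s in a..b, g s) * x = 0 := by simpa using key.symm
  exact sub_eq_zero.mp this

theorem Commute.intervalIntegral_left {x : 𝔸} {g : ℝ → 𝔸} {a b : ℝ}
    (hg : IntervalIntegrable g volume a b) (h : ∀ s, Commute (g s) x) :
    Commute (∫ s in a..b, g s) x :=
  (Commute.intervalIntegral_right hg fun s => (h s).symm).symm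

theorem hasDerivAt_exp_neg_of_commute {F : ℝ → 𝔸} {F' : 𝔸} {t : ℝ}
    (hF : HasDerivAt F F' t) (hcomm : ∀ s, Commute (F t) (F s)) :
    HasDerivAt (fun s => exp (-F s)) (-(exp (-F t) * F')) t := by
  -- Commutation factors out `exp (-F t)`, so only the derivative of `exp` at `0` is needed.
  have e : (fun s => exp (-F s)) = fun s => exp (-F t) * exp (-(F s - F t)) := by
    funext s
    let _ : NormedAlgebra ℚ 𝔸 := NormedAlgebra.restrictScalars ℚ ℝ 𝔸
    rw [← exp_add_of_commute]
    · congr 1; abel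
    · exact (((hcomm s).sub_right (Commute.refl _)).neg_left).neg_right
  rw [e]
  have h1 : HasDerivAt (fun s => -(F s - F t)) (-F') t := (hF.sub_const _).neg
  have h0 : HasFDerivAt (exp : 𝔸 → 𝔸) (1 : 𝔸 →L[ℝ] 𝔸) ((fun s => -(F s - F t)) t) := by
    simpa using hasFDerivAt_exp_zero (𝕂 := ℝ) (𝔸 := 𝔸)
  have h2 := (h0.comp_hasDerivAt t h1).const_mul (exp (-F t))
  simpa using h2

/-- An element `a` has a logarithm as soon as the segment from `1` to `a` consists of units. -/
theorem exists_exp_eq_of_isUnit_segment (a : 𝔸)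
    (ha : ∀ s ∈ Icc (0 : ℝ) 1, IsUnit (1 + s • (a - 1))) : ∃ x : 𝔸, exp x = a := by
  let _ : NormedAlgebra ℚ 𝔸 := NormedAlgebra.restrictScalars ℚ ℝ 𝔸
  -- Clamping to `[0, 1]` makes the integrand `L' L⁻¹` continuous on all of `ℝ`; its integral `F` is
  -- the candidate for `log L`.
  set c : ℝ → ℝ := fun s => (projIcc (0 : ℝ) 1 zero_le_one s : ℝ)
  have hc : Continuous c := continuous_subtype_val.comp continuous_projIcc
  set L : ℝ → 𝔸 := fun s => 1 + s • (a - 1) with hL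
  have hLc : ∀ s, IsUnit (L (c s)) := fun s => ha _ (projIcc (0 : ℝ) 1 zero_le_one s).2
  have hcommL : ∀ s t, Commute (L s) (L t) := fun s t =>
    ((Commute.one_left _).add_left (((Commute.one_right _).add_right
      ((Commute.refl _).smul_right t)).smul_left s))
  have hcommA : ∀ s, Commute (a - 1) (L s) := fun s =>
    (Commute.one_right _).add_right ((Commute.refl _).smul_right s)
  set g : ℝ → 𝔸 := fun s => (a - 1) * Ring.inverse (L (c s)) with hg
  have hgc : Continuous g := by
    refine continuous_const.mul (continuous_iff_continuousAt.mpr fun s => ?_)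
    obtain ⟨u, hu⟩ := hLc s
    have h1 : ContinuousAt Ring.inverse (L (c s)) := hu ▸ NormedRing.inverse_continuousAt u
    exact ContinuousAt.comp (g := Ring.inverse) (f := fun s => L (c s)) h1
      (by fun_prop)
  have hcommg : ∀ s t, Commute (g s) (g t) := fun s t => by
    have h1 : ∀ r, Commute (a - 1) (Ring.inverse (L (c r))) := fun r => by
      obtain ⟨u, hu⟩ := hLc r
      have := hcommA (c r)
      rw [← hu] at this ⊢
      rw [Ring.inverse_unit]
      exact this.units_inv_right
    exact ((Commute.refl _).mul_right (h1 t)).mul_left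
      ((h1 s).symm.mul_right ((hcommL (c s) (c t)).ringInverse_ringInverse))
  set F : ℝ → 𝔸 := fun t => ∫ s in (0 : ℝ)..t, g s with hFdef
  have hint : ∀ t, IntervalIntegrable g volume 0 t := fun t => hgc.intervalIntegrable _ _
  have hF : ∀ t, HasDerivAt F (g t) t := fun t =>
    intervalIntegral.integral_hasDerivAt_right (hint t)
      hgc.aestronglyMeasurable.stronglyMeasurableAtFilter hgc.continuousAt
  have hcommF : ∀ t s, Commute (F t) (F s) := fun t s =>
    Commute.intervalIntegral_left (hint t) fun r =>
      Commute.intervalIntegral_right (hint s) fun r' => hcommg r r'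
  have hLd : ∀ t, HasDerivAt L (a - 1) t := fun t => by
    simpa only [one_smul] using ((hasDerivAt_id' t).smul_const (a - 1)).const_add 1
  have hW : ∀ t, HasDerivAt (fun t => exp (-F t) * L t)
      (-(exp (-F t) * g t) * L t + exp (-F t) * (a - 1)) t := fun t =>
    (hasDerivAt_exp_neg_of_commute (hF t) (hcommF t)).mul (hLd t)
  have hW0 : ∀ t ∈ Ico (0 : ℝ) 1,
      HasDerivWithinAt (fun t => exp (-F t) * L t) 0 (Ici t) t := fun t ht => by
    have hct : c t = t := by
      simp only [c]; rw [projIcc_of_mem zero_le_one ⟨ht.1, ht.2.le⟩]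
    have h1 : g t * L t = a - 1 := by
      have := hLc t
      simp only [hg]
      rw [hct] at this ⊢
      rw [mul_assoc, Ring.inverse_mul_cancel _ this, mul_one]
    have := (hW t).hasDerivWithinAt (s := Ici t)
    rwa [neg_mul, mul_assoc, h1, neg_add_cancel] at this
  have hconst := constant_of_has_deriv_right_zero
    (fun t _ => (hW t).continuousAt.continuousWithinAt) hW0 1 (right_mem_Icc.mpr zero_le_one)
  have hF0 : F 0 = 0 := by simp [hFdef]
  have hL0 : L 0 = 1 := by simp [hL]
  have hL1 : L 1 = a := by simp [hL]
  simp only [hF0, hL0, hL1, neg_zero, exp_zero, one_mul] at hconst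
  refine ⟨F 1, ?_⟩
  have h2 : exp (F 1) * exp (-F 1) = 1 := by
    rw [← exp_add_of_commute (Commute.neg_right (Commute.refl _)), add_neg_cancel, exp_zero]
  calc exp (F 1) = exp (F 1) * (exp (-F 1) * a) := by rw [hconst, mul_one]
    _ = a := by rw [← mul_assoc, h2, one_mul]

end Logarithm

/-! ### Sufficient and necessary conditions for a real logarithm -/

section Kstar

open Matrix

variable {n : ℕ}

theorem mem_Kstar_of_det_ne_zero {A : Matrix (Fin n) (Fin n) ℝ}
    (h : ∀ x : ℝ, 0 ≤ x → (A + x • (1 : Matrix (Fin n) (Fin n) ℝ)).det ≠ 0) : A ∈ Kstar n := by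
  open scoped Matrix.Norms.Operator in
  refine exists_exp_eq_of_isUnit_segment A fun s hs => ?_
  rcases hs.1.eq_or_lt with h0 | h0
  · simp [← h0]
  · rw [Matrix.isUnit_iff_isUnit_det, isUnit_iff_ne_zero]
    have e : (1 : Matrix (Fin n) (Fin n) ℝ) + s • (A - 1)
        = s • (A + ((1 - s) / s) • (1 : Matrix (Fin n) (Fin n) ℝ)) := by
      rw [smul_add, smul_smul, mul_div_cancel₀ _ h0.ne', smul_sub, sub_smul, one_smul]
      abel
    rw [e, Matrix.det_smul]
    exact mul_ne_zero (pow_ne_zero _ h0.ne')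
      (h _ (div_nonneg (by linarith [hs.2]) h0.le))

theorem det_ne_zero_of_mem_Kstar {A : Matrix (Fin n) (Fin n) ℝ} (h : A ∈ Kstar n) :
    A.det ≠ 0 := by
  obtain ⟨X, rfl⟩ := h
  exact ((Matrix.isUnit_iff_isUnit_det _).mp (Matrix.isUnit_exp X)).ne_zero

/-- Over `ℂ`, `Y² + x = (Y + i√x)(Y - i√x)`, and the two factors have conjugate determinants. -/
theorem det_mul_self_add_smul_one_nonneg (Y : Matrix (Fin n) (Fin n) ℝ) {x : ℝ} (hx : 0 ≤ x) :
    0 ≤ (Y * Y + x • (1 : Matrix (Fin n) (Fin n) ℝ)).det := by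
  set Z : Matrix (Fin n) (Fin n) ℂ := Y.map Complex.ofRealHom
  set w : ℂ := Complex.I * (Real.sqrt x : ℂ)
  have hw : w * w = -(x : ℂ) := by
    have : ((Real.sqrt x : ℝ) : ℂ) * (Real.sqrt x : ℝ) = (x : ℂ) := by
      rw [← Complex.ofReal_mul, Real.mul_self_sqrt hx]
    linear_combination (Complex.I * Complex.I) * this + (x : ℂ) * Complex.I_mul_I
  have h1 : (((Y * Y + x • (1 : Matrix (Fin n) (Fin n) ℝ)).det : ℝ) : ℂ)
      = (Z + w • 1).det * (Z - w • 1).det := by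
    rw [← Matrix.det_mul]
    change Complex.ofRealHom _ = _
    rw [RingHom.map_det]
    congr 1
    rw [map_add, map_mul]
    have : (Complex.ofRealHom.mapMatrix (x • (1 : Matrix (Fin n) (Fin n) ℝ)))
        = (x : ℂ) • (1 : Matrix (Fin n) (Fin n) ℂ) := by
      ext i j
      by_cases hij : i = j <;> simp [hij]
    rw [this]
    have hww : w • w • (1 : Matrix (Fin n) (Fin n) ℂ) = -((x : ℂ) • 1) := by
      rw [smul_smul, hw, neg_smul]
    simp only [add_mul, mul_sub, smul_mul_assoc, mul_smul_comm, one_mul, mul_one, smul_add,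
      hww]
    simp only [RingHom.mapMatrix_apply, Z]
    abel
  have h2 : (Z - w • 1).det = (starRingEnd ℂ) (Z + w • 1).det := by
    rw [RingHom.map_det]
    congr 1
    ext i j
    by_cases hij : i = j <;> simp [Z, w, hij, sub_eq_add_neg]
  rw [h2, Complex.mul_conj] at h1
  rw [Complex.ofReal_inj.mp h1]
  exact Complex.normSq_nonneg _

theorem det_add_smul_one_nonneg_of_mem_Kstar {A : Matrix (Fin n) (Fin n) ℝ} (h : A ∈ Kstar n)
    {x : ℝ} (hx : 0 ≤ x) : 0 ≤ (A + x • (1 : Matrix (Fin n) (Fin n) ℝ)).det := by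
  obtain ⟨X, rfl⟩ := h
  -- An exponential is a square.
  have : NormedSpace.exp X = NormedSpace.exp ((1 / 2 : ℝ) • X)
      * NormedSpace.exp ((1 / 2 : ℝ) • X) := by
    rw [← Matrix.exp_add_of_commute _ _ (Commute.refl _), ← add_smul]
    norm_num
  rw [this]
  exact det_mul_self_add_smul_one_nonneg _ hx

end Kstar

/-! ### Discriminants and polynomial curves of matrices -/

section PolynomialCurves

open Matrix Polynomial

variable {ι : Type*} [Fintype ι] [DecidableEq ι]

/-- The determinant of `p'(B)`, where `p` is the characteristic polynomial of `B`. Up to sign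
this is the discriminant of `p`. -/
noncomputable def charpolyDerivDet {R : Type*} [CommRing R] (B : Matrix ι ι R) : R :=
  (aeval B (derivative B.charpoly)).det

theorem charpolyDerivDet_map {R S : Type*} [CommRing R] [CommRing S] (f : R →+* S)
    (B : Matrix ι ι R) : charpolyDerivDet (B.map f) = f (charpolyDerivDet B) := by
  unfold charpolyDerivDet
  rw [Matrix.charpoly_map, Polynomial.derivative_map, RingHom.map_det]
  congr 1
  simp only [Polynomial.aeval_def, Polynomial.eval₂_map]
  rw [← RingHom.mapMatrix_apply, Polynomial.hom_eval₂]
  congr 1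
  ext r i j
  by_cases hij : i = j <;> simp [Matrix.algebraMap_matrix_apply, hij]

theorem charpolyDerivDet_add_smul_one {R : Type*} [CommRing R] (B : Matrix ι ι R) (x : R) :
    charpolyDerivDet (B + x • 1) = charpolyDerivDet B := by
  have h := Matrix.charpoly_sub_scalar B (-x)
  have e : B - Matrix.scalar ι (-x) = B + x • 1 := by
    rw [map_neg, sub_neg_eq_add, Matrix.scalar_apply, Matrix.smul_one_eq_diagonal]
  rw [e] at h
  unfold charpolyDerivDet
  rw [h, Polynomial.derivative_comp, Polynomial.aeval_mul, Polynomial.aeval_comp]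
  simp [Algebra.algebraMap_eq_smul_one]

theorem charpolyDerivDet_diagonal_ne_zero {K : Type*} [Field K] {d : ι → K}
    (hd : Function.Injective d) : charpolyDerivDet (diagonal d) ≠ 0 := by
  unfold charpolyDerivDet
  have e : aeval (diagonal d) (derivative (diagonal d).charpoly)
      = diagonal (fun i => (derivative (diagonal d).charpoly).eval (d i)) := by
    have := Polynomial.aeval_algHom_apply (Matrix.diagonalAlgHom (n := ι) K (α := K)) d
      (derivative (diagonal d).charpoly)
    rw [Matrix.diagonalAlgHom_apply] at this
    rw [this, Matrix.diagonalAlgHom_apply]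
    congr 1
    funext i
    simp
  rw [e, det_diagonal, Finset.prod_ne_zero_iff]
  intro i _
  rw [charpoly_diagonal, Polynomial.derivative_prod_finset,
    Polynomial.eval_finsetSum,
    Finset.sum_eq_single i]
  · simp only [derivative_sub, derivative_X, derivative_C, sub_zero, mul_one, eval_prod,
      eval_sub, eval_X, eval_C]
    rw [Finset.prod_ne_zero_iff]
    exact fun j hj => sub_ne_zero.mpr fun h => (Finset.mem_erase.mp hj).1 (hd h).symm
  · intro j _ hj
    rw [eval_mul, eval_prod, Finset.prod_eq_zero (i := i), zero_mul]
    · exact Finset.mem_erase.mpr ⟨hj.symm, Finset.mem_univ _⟩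
    · simp
  · simp

/-- If `p'` is divisible by `X - x`, then `p'(B)` kills an eigenvector of `B` for `x`. -/
theorem charpolyDerivDet_eq_zero {K : Type*} [Field K] {B : Matrix ι ι K} {x : K}
    (h0 : B.charpoly.IsRoot x) (h1 : (derivative B.charpoly).IsRoot x) :
    charpolyDerivDet B = 0 := by
  have hdet : (Matrix.scalar ι x - B).det = 0 := by
    rw [← Matrix.eval_charpoly]; exact h0
  obtain ⟨v, hv, hBv⟩ := Matrix.exists_mulVec_eq_zero_iff.mpr hdet
  obtain ⟨q, hq⟩ := Polynomial.dvd_iff_isRoot.mpr h1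
  refine Matrix.exists_mulVec_eq_zero_iff.mp ⟨v, hv, ?_⟩
  rw [hq, mul_comm, Polynomial.aeval_mul, ← Matrix.mulVec_mulVec]
  have : (aeval B (X - C x)) *ᵥ v = 0 := by
    rw [map_sub, aeval_X, aeval_C, ← neg_sub, Matrix.neg_mulVec, neg_eq_zero]
    exact hBv
  rw [this, Matrix.mulVec_zero]

/-- A curve of matrices all of whose entries are polynomials in the parameter. -/
def IsPolynomialCurve (Γ : ℝ → Matrix ι ι ℝ) : Prop :=
  ∃ P : Matrix ι ι ℝ[X], ∀ t, Γ t = P.map (Polynomial.evalRingHom t)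

omit [Fintype ι] [DecidableEq ι] in
theorem IsPolynomialCurve.of_entries {Γ : ℝ → Matrix ι ι ℝ}
    (h : ∀ i j, ∃ p : ℝ[X], ∀ t, Γ t i j = p.eval t) : IsPolynomialCurve Γ := by
  choose P hP using h
  exact ⟨Matrix.of P, fun t => by ext i j; simp [hP]⟩

omit [Fintype ι] [DecidableEq ι] in
theorem IsPolynomialCurve.line (A B : Matrix ι ι ℝ) :
    IsPolynomialCurve fun t : ℝ => A + t • B :=
  .of_entries fun i j => ⟨C (A i j) + C (B i j) * X, fun t => by
    simp [mul_comm t]⟩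

omit [DecidableEq ι] in
theorem IsPolynomialCurve.mul {Γ Δ : ℝ → Matrix ι ι ℝ} (hΓ : IsPolynomialCurve Γ)
    (hΔ : IsPolynomialCurve Δ) : IsPolynomialCurve fun t => Γ t * Δ t := by
  obtain ⟨P, hP⟩ := hΓ
  obtain ⟨Q, hQ⟩ := hΔ
  exact ⟨P * Q, fun t => by simp only [hP, hQ, Matrix.map_mul]⟩

theorem IsPolynomialCurve.linearMap_comp {Γ : ℝ → Matrix ι ι ℝ} (hΓ : IsPolynomialCurve Γ)
    (φ : Matrix ι ι ℝ →ₗ[ℝ] Matrix ι ι ℝ) : IsPolynomialCurve fun t => φ (Γ t) := by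
  obtain ⟨P, hP⟩ := hΓ
  refine .of_entries fun i j => ⟨∑ k, ∑ l, P k l * C (φ (Matrix.single k l 1) i j), fun t => ?_⟩
  rw [Matrix.matrix_eq_sum_single (Γ t)]
  have e : ∀ k l, Matrix.single k l (Γ t k l) = (P k l).eval t • Matrix.single k l (1 : ℝ) :=
    fun k l => by simp [hP]
  simp only [e, map_sum, map_smul, Matrix.sum_apply, Matrix.smul_apply, smul_eq_mul,
    Polynomial.eval_finsetSum, Polynomial.eval_mul, Polynomial.eval_C]

theorem IsPolynomialCurve.exists_det_eq {Γ : ℝ → Matrix ι ι ℝ} (hΓ : IsPolynomialCurve Γ) :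
    ∃ p : ℝ[X], ∀ t, (Γ t).det = p.eval t := by
  obtain ⟨P, hP⟩ := hΓ
  refine ⟨P.det, fun t => ?_⟩
  rw [hP, ← RingHom.mapMatrix_apply, ← RingHom.map_det, Polynomial.coe_evalRingHom]

theorem IsPolynomialCurve.exists_charpolyDerivDet_eq {Γ : ℝ → Matrix ι ι ℝ}
    (hΓ : IsPolynomialCurve Γ) : ∃ p : ℝ[X], ∀ t, charpolyDerivDet (Γ t) = p.eval t := by
  obtain ⟨P, hP⟩ := hΓ
  exact ⟨charpolyDerivDet P, fun t => by
    rw [hP, charpolyDerivDet_map, Polynomial.coe_evalRingHom]⟩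

theorem eval_charpoly_neg (B : Matrix ι ι ℝ) (x : ℝ) :
    B.charpoly.eval (-x) = (-1) ^ Fintype.card ι * (B + x • (1 : Matrix ι ι ℝ)).det := by
  rw [Matrix.eval_charpoly, ← Matrix.det_neg]
  congr 1
  rw [neg_add, map_neg, Matrix.scalar_apply, Matrix.smul_one_eq_diagonal]
  abel

/-- If `det (B + x)` is nonnegative for `x ≥ 0` and vanishes at some `x ≥ 0`, then `B` is
singular or its characteristic polynomial has a double root. -/
theorem det_mul_charpolyDerivDet_eq_zero {B : Matrix ι ι ℝ}
    (h : ∀ x : ℝ, 0 ≤ x → 0 ≤ (B + x • (1 : Matrix ι ι ℝ)).det) {x : ℝ} (hx : 0 ≤ x)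
    (h0 : (B + x • (1 : Matrix ι ι ℝ)).det = 0) : B.det * charpolyDerivDet B = 0 := by
  rcases hx.eq_or_lt with rfl | hx
  · rw [zero_smul, add_zero] at h0
    rw [h0, zero_mul]
  refine mul_eq_zero_of_right _ (charpolyDerivDet_eq_zero (x := -x) ?_ ?_)
  · rw [Polynomial.IsRoot, eval_charpoly_neg, h0, mul_zero]
  set g : ℝ → ℝ := fun y => (-1) ^ Fintype.card ι * B.charpoly.eval y
  have hg : ∀ y, g (-y) = (B + y • (1 : Matrix ι ι ℝ)).det := fun y => by
    simp only [g]
    rw [eval_charpoly_neg, ← mul_assoc, ← mul_pow]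
    simp
  -- A zero of a nonnegative function, interior because `x > 0`, is a minimum, so the derivative
  -- vanishes there too.
  have hmin : IsLocalMin g (-x) := by
    filter_upwards [Iio_mem_nhds (neg_lt_zero.mpr hx)] with y hy
    rw [hg, h0, ← neg_neg y, hg]
    exact h _ (neg_nonneg.mpr (le_of_lt hy))
  have hd : HasDerivAt g ((-1) ^ Fintype.card ι * (derivative B.charpoly).eval (-x)) (-x) :=
    (B.charpoly.hasDerivAt (-x)).const_mul _
  have := hmin.hasDerivAt_eq_zero hd
  exact (mul_eq_zero.mp this).resolve_left (pow_ne_zero _ (by norm_num))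

theorem exists_forall_ge_det_add_smul_one_ne_zero (A : Matrix ι ι ℝ) :
    ∃ T : ℝ, ∀ x, T ≤ x → (A + x • (1 : Matrix ι ι ℝ)).det ≠ 0 := by
  obtain ⟨M, hM⟩ := (A.charpoly.roots.toFinset.image fun y => -y).bddAbove
  refine ⟨M + 1, fun x hx h => ?_⟩
  have : x ∈ (A.charpoly.roots.toFinset.image fun y => -y) := by
    refine Finset.mem_image.mpr ⟨-x, ?_, neg_neg x⟩
    rw [Multiset.mem_toFinset, Polynomial.mem_roots A.charpoly_monic.ne_zero,
      Polynomial.IsRoot, eval_charpoly_neg, h, mul_zero]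
  linarith [hM this]

theorem exists_det_add_smul_one_eq_zero {A : Matrix ι ι ℝ} (h : A.det < 0) :
    ∃ x : ℝ, (A + x • (1 : Matrix ι ι ℝ)).det = 0 := by
  set q : ℝ → ℝ := fun r => ((1 - r) • A + r • (1 : Matrix ι ι ℝ)).det
  have hq : Continuous q := by
    refine Continuous.matrix_det ?_
    fun_prop
  have hmem : (0 : ℝ) ∈ Set.Icc (q 0) (q 1) := by
    constructor
    · simpa [q] using h.le
    · simp [q]
  obtain ⟨r, hr, hr0⟩ := intermediate_value_Icc zero_le_one hq.continuousOn hmem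
  have h1 : 1 - r ≠ 0 := fun h1 => by
    have : r = 1 := by linarith
    simp [q, this] at hr0
  refine ⟨r / (1 - r), ?_⟩
  have e : (1 - r) • A + r • (1 : Matrix ι ι ℝ)
      = (1 - r) • (A + (r / (1 - r)) • (1 : Matrix ι ι ℝ)) := by
    rw [smul_add, smul_smul, mul_div_cancel₀ _ h1]
  simp only [q] at hr0
  rw [e, det_smul] at hr0
  exact (mul_eq_zero.mp hr0).resolve_left (pow_ne_zero _ h1)

end PolynomialCurves

/-! ### Linear bijections preserving `Kstar` -/

section KstarPreservers

open Matrix Polynomial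

variable {n : ℕ}

/-- The matrix `|u|² - u uᵀ`, a multiple of the orthogonal projection with kernel `u`. -/
def orthProj (u : Fin n → ℝ) : Matrix (Fin n) (Fin n) ℝ :=
  (u ⬝ᵥ u) • 1 - vecMulVec u u

theorem orthProj_mulVec (u x : Fin n → ℝ) :
    orthProj u *ᵥ x = (u ⬝ᵥ u) • x - (u ⬝ᵥ x) • u := by
  rw [orthProj, sub_mulVec, smul_mulVec, one_mulVec, vecMulVec_mulVec]
  simp

theorem vecMul_orthProj (u : Fin n → ℝ) : u ᵥ* orthProj u = 0 := by
  rw [orthProj, vecMul_sub, vecMul_smul, vecMul_one, vecMul_vecMulVec, sub_self]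

theorem orthProj_mul {u : Fin n → ℝ} {A : Matrix (Fin n) (Fin n) ℝ} (h : u ᵥ* A = 0) :
    orthProj u * A = (u ⬝ᵥ u) • A := by
  rw [orthProj, sub_mul, smul_mul, one_mul, vecMulVec_mul, h]
  simp

theorem det_orthProj (hn : 0 < n) (u : Fin n → ℝ) : (orthProj u).det = 0 := by
  by_cases hu : u = 0
  · have : Nonempty (Fin n) := ⟨⟨0, hn⟩⟩
    simp [hu, orthProj]
  · exact exists_vecMul_eq_zero_iff.mp ⟨u, hu, vecMul_orthProj u⟩

/-- An eigenvector for `-x ≠ 0` is orthogonal to the left kernel vector `u`, and there `t • orthProj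
u` acts as the scalar `t|u|²`, which pushes negative eigenvalues away for large `t`. -/
theorem exists_forall_det_add_smul_orthProj_ne_zero {A : Matrix (Fin n) (Fin n) ℝ}
    {u : Fin n → ℝ} (hu : u ≠ 0) (hA : u ᵥ* A = 0) :
    ∃ T : ℝ, ∀ t, T ≤ t → ∀ x : ℝ, 0 < x →
      (A + t • orthProj u + x • (1 : Matrix (Fin n) (Fin n) ℝ)).det ≠ 0 := by
  obtain ⟨T, hT⟩ := exists_forall_ge_det_add_smul_one_ne_zero A
  have hpos : 0 < u ⬝ᵥ u := by
    have := dotProduct_star_self_pos_iff.mpr hu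
    rwa [star_trivial] at this
  refine ⟨T / (u ⬝ᵥ u), fun t ht x hx hdet => ?_⟩
  obtain ⟨v, hv, hAv⟩ := exists_mulVec_eq_zero_iff.mpr hdet
  have huv : u ⬝ᵥ v = 0 := by
    have h1 : u ⬝ᵥ ((A + t • orthProj u + x • (1 : Matrix (Fin n) (Fin n) ℝ)) *ᵥ v) = 0 := by
      rw [hAv, dotProduct_zero]
    rw [dotProduct_mulVec, vecMul_add, vecMul_add, hA, vecMul_smul, vecMul_orthProj, vecMul_smul,
      vecMul_one, smul_zero, zero_add, zero_add, smul_dotProduct, smul_eq_mul] at h1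
    exact (mul_eq_zero.mp h1).resolve_left hx.ne'
  refine hT (t * (u ⬝ᵥ u) + x) ?_ (exists_mulVec_eq_zero_iff.mp ⟨v, hv, ?_⟩)
  · rw [div_le_iff₀ hpos] at ht
    linarith
  · rw [add_mulVec, add_mulVec, smul_mulVec, orthProj_mulVec, huv, zero_smul, sub_zero,
      smul_smul] at hAv
    rw [add_mulVec, smul_mulVec, one_mulVec, add_smul, ← add_assoc]
    rw [smul_mulVec, one_mulVec] at hAv
    exact hAv

variable {e : Matrix (Fin n) (Fin n) ℝ ≃ₗ[ℝ] Matrix (Fin n) (Fin n) ℝ}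

theorem det_mul_charpolyDerivDet_map_eq_zero_of_forall_pos
    (he : ∀ A, e A ∈ Kstar n ↔ A ∈ Kstar n) {A : Matrix (Fin n) (Fin n) ℝ} (hA : A.det = 0)
    (h : ∀ x : ℝ, 0 < x → (A + x • (1 : Matrix (Fin n) (Fin n) ℝ)).det ≠ 0) :
    (e A).det * charpolyDerivDet (e A) = 0 := by
  have hnot : e A ∉ Kstar n := fun hmem => det_ne_zero_of_mem_Kstar ((he A).mp hmem) hA
  have hnonneg : ∀ x : ℝ, 0 ≤ x → 0 ≤ (e A + x • (1 : Matrix (Fin n) (Fin n) ℝ)).det := by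
    intro x hx
    have hc : Continuous fun ε : ℝ =>
        (e A + ε • e 1 + x • (1 : Matrix (Fin n) (Fin n) ℝ)).det :=
      Continuous.matrix_det (by fun_prop)
    have hlim := (hc.tendsto 0).mono_left (nhdsWithin_le_nhds (s := Set.Ioi 0))
    rw [zero_smul, add_zero] at hlim
    refine ge_of_tendsto hlim ?_
    filter_upwards [self_mem_nhdsWithin] with ε hε
    rw [← map_smul, ← map_add]
    refine det_add_smul_one_nonneg_of_mem_Kstar ((he _).mpr ?_) hx
    refine mem_Kstar_of_det_ne_zero fun y hy => ?_
    rw [add_assoc, ← add_smul]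
    exact h _ (add_pos_of_pos_of_nonneg hε hy)
  obtain ⟨x, hx, hx0⟩ : ∃ x : ℝ, 0 ≤ x ∧
      (e A + x • (1 : Matrix (Fin n) (Fin n) ℝ)).det = 0 := by
    by_contra! hcon
    exact hnot (mem_Kstar_of_det_ne_zero hcon)
  exact det_mul_charpolyDerivDet_eq_zero hnonneg hx hx0

theorem det_mul_charpolyDerivDet_map_eq_zero
    (he : ∀ A, e A ∈ Kstar n ↔ A ∈ Kstar n) {A : Matrix (Fin n) (Fin n) ℝ} (hA : A.det = 0) :
    (e A).det * charpolyDerivDet (e A) = 0 := by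
  obtain ⟨u, hu, huA⟩ := exists_vecMul_eq_zero_iff.mpr hA
  obtain ⟨T, hT⟩ := exists_forall_det_add_smul_orthProj_ne_zero hu huA
  have hcurve := (IsPolynomialCurve.line A (orthProj u)).linearMap_comp e.toLinearMap
  obtain ⟨p, hp⟩ := hcurve.exists_det_eq
  obtain ⟨q, hq⟩ := hcurve.exists_charpolyDerivDet_eq
  -- The product vanishes for all large `t`, hence also at `t = 0`, where the curve passes through
  -- `e A`.
  have hpq : p * q = 0 := by
    refine Polynomial.eq_zero_of_infinite_isRoot _ ((Set.Ici_infinite T).mono fun t ht => ?_)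
    rw [Set.mem_ofPred_eq, Polynomial.IsRoot, eval_mul, ← hp, ← hq]
    refine det_mul_charpolyDerivDet_map_eq_zero_of_forall_pos he ?_ (hT t ht)
    exact exists_vecMul_eq_zero_iff.mp
      ⟨u, hu, by rw [vecMul_add, huA, vecMul_smul, vecMul_orthProj, smul_zero, add_zero]⟩
  have h0 := congrArg (Polynomial.eval 0) hpq
  rw [eval_mul, ← hp, ← hq] at h0
  simpa using h0

/-- With `J = e.symm 1`, adding `x • J` shifts the image by a scalar and keeps its discriminant. So
it suffices to find `C` with `det C < 0` and `e (J * C)` of nonzero discriminant: some shift `C + x`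
is then singular. Such a `C` is found near `C₁` on the line towards `C₀`, whose image has distinct
eigenvalues. -/
theorem exists_det_eq_zero_charpolyDerivDet_map_ne_zero (hn : 0 < n)
    (he : ∀ A, e A ∈ Kstar n ↔ A ∈ Kstar n) :
    ∃ A : Matrix (Fin n) (Fin n) ℝ, A.det = 0 ∧ charpolyDerivDet (e A) ≠ 0 := by
  set J := e.symm 1
  have hJ : J.det ≠ 0 := by
    refine det_ne_zero_of_mem_Kstar ((he _).mp ?_)
    rw [e.apply_symm_apply]
    exact ⟨0, NormedSpace.exp_zero⟩
  set C₀ : Matrix (Fin n) (Fin n) ℝ := J⁻¹ * e.symm (diagonal fun i => (i : ℝ))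
  set C₁ : Matrix (Fin n) (Fin n) ℝ := diagonal (Function.update 1 ⟨0, hn⟩ (-1))
  have hC₁ : C₁.det < 0 := by
    rw [det_diagonal, Finset.prod_update_of_mem (Finset.mem_univ _)]
    simp
  have hJC₀ : J * C₀ = e.symm (diagonal fun i => (i : ℝ)) :=
    mul_nonsing_inv_cancel_left _ _ (isUnit_iff_ne_zero.mpr hJ)
  obtain ⟨p, hp⟩ := ((IsPolynomialCurve.line (J * C₁)
    (J * C₀ - J * C₁)).linearMap_comp e.toLinearMap).exists_charpolyDerivDet_eq
  have hp0 : p ≠ 0 := by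
    rintro rfl
    have h1 := hp 1
    rw [one_smul, add_sub_cancel, hJC₀, eval_zero] at h1
    refine charpolyDerivDet_diagonal_ne_zero (K := ℝ) (d := fun i : Fin n => (i : ℝ)) ?_
      (by simpa using h1)
    exact fun i j hij => Fin.ext (Nat.cast_injective (R := ℝ) hij)
  have hnhds : {s : ℝ | (C₁ + s • (C₀ - C₁)).det < 0} ∈ nhds (0 : ℝ) := by
    have hc : Continuous fun s : ℝ => (C₁ + s • (C₀ - C₁)).det :=
      Continuous.matrix_det (by fun_prop)
    refine (isOpen_lt hc continuous_const).mem_nhds ?_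
    simpa using hC₁
  obtain ⟨s, hs, hps⟩ : ∃ s : ℝ, (C₁ + s • (C₀ - C₁)).det < 0 ∧ p.eval s ≠ 0 := by
    by_contra! hcon
    exact hp0 (Polynomial.eq_zero_of_infinite_isRoot _ ((infinite_of_mem_nhds 0 hnhds).mono hcon))
  obtain ⟨x, hx⟩ := exists_det_add_smul_one_eq_zero hs
  refine ⟨J * (C₁ + s • (C₀ - C₁) + x • 1), by rw [det_mul, hx, mul_zero], ?_⟩
  rw [mul_add, mul_smul_comm, mul_one, map_add, map_smul, e.apply_symm_apply,
    charpolyDerivDet_add_smul_one, mul_add, mul_smul_comm, mul_sub]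
  rw [← hp] at hps
  exact hps

theorem IsPolynomialCurve.orthProj_line (u v : Fin n → ℝ) :
    IsPolynomialCurve fun t : ℝ => orthProj (u + t • v) := by
  refine .of_entries fun i j => ⟨(∑ k, (C (u k) + X * C (v k)) * (C (u k) + X * C (v k))) *
    C ((1 : Matrix (Fin n) (Fin n) ℝ) i j)
      - (C (u i) + X * C (v i)) * (C (u j) + X * C (v j)), fun t => ?_⟩
  simp [orthProj, dotProduct, vecMulVec_apply, Polynomial.eval_finsetSum, mul_comm t]

/-- A linear bijection preserving `Kstar n` in both directions preserves singularity. -/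
theorem det_map_eq_zero (he : ∀ A, e A ∈ Kstar n ↔ A ∈ Kstar n)
    {A : Matrix (Fin n) (Fin n) ℝ} (hA : A.det = 0) : (e A).det = 0 := by
  have hn : 0 < n := Nat.pos_of_ne_zero fun h => by
    subst h
    simp at hA
  obtain ⟨B, hB, hBe⟩ := exists_det_eq_zero_charpolyDerivDet_map_ne_zero hn he
  obtain ⟨u, hu, huA⟩ := exists_vecMul_eq_zero_iff.mpr hA
  obtain ⟨v, hv, hvB⟩ := exists_vecMul_eq_zero_iff.mpr hB
  have hu' : u ⬝ᵥ u ≠ 0 := fun h => hu (dotProduct_self_eq_zero.mp h)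
  have hv' : v ⬝ᵥ v ≠ 0 := fun h => hv (dotProduct_self_eq_zero.mp h)
  set A' := (u ⬝ᵥ u)⁻¹ • A
  set B' := (v ⬝ᵥ v)⁻¹ • B
  -- The factor `orthProj` keeps the curve singular, even where `u + t • (v - u) = 0`; the scalings
  -- in `A'` and `B'` make its endpoints exactly `A` and `B`.
  have hcurve := ((IsPolynomialCurve.orthProj_line u (v - u)).mul
    (IsPolynomialCurve.line A' (B' - A'))).linearMap_comp e.toLinearMap
  obtain ⟨p, hp⟩ := hcurve.exists_det_eq
  obtain ⟨q, hq⟩ := hcurve.exists_charpolyDerivDet_eq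
  have hpq : p * q = 0 := Polynomial.funext fun t => by
    rw [eval_mul, ← hp, ← hq, eval_zero]
    refine det_mul_charpolyDerivDet_map_eq_zero he ?_
    rw [det_mul, det_orthProj hn, zero_mul]
  have hq0 : q ≠ 0 := by
    rintro rfl
    have h1 := hq 1
    rw [one_smul, one_smul, add_sub_cancel, add_sub_cancel, mul_smul_comm, orthProj_mul hvB,
      smul_smul, inv_mul_cancel₀ hv', one_smul, eval_zero] at h1
    exact hBe h1
  have h0 := hp 0
  rw [(mul_eq_zero.mp hpq).resolve_right hq0, zero_smul, zero_smul, add_zero, add_zero,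
    mul_smul_comm, orthProj_mul huA, smul_smul, inv_mul_cancel₀ hu', one_smul, eval_zero] at h0
  exact h0

end KstarPreservers

theorem mainTheorem4 (n : ℕ)
    (φ : Matrix (Fin n) (Fin n) ℝ →ₗ[ℝ] Matrix (Fin n) (Fin n) ℝ)
    (hφ : Function.Bijective φ) (hK : φ '' Kstar n = Kstar n) :
    φ '' GLset n = GLset n := by
  set e := LinearEquiv.ofBijective φ hφ
  have heφ : ∀ A, e A = φ A := fun _ => rfl
  have he : ∀ A, e A ∈ Kstar n ↔ A ∈ Kstar n := fun A => by
    rw [heφ]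
    conv_lhs => rw [← hK]
    exact hφ.1.mem_set_image
  have he' : ∀ A, e.symm A ∈ Kstar n ↔ A ∈ Kstar n := fun A => by
    rw [← he, e.apply_symm_apply]
  have hmem : ∀ A : Matrix (Fin n) (Fin n) ℝ, A ∈ GLset n ↔ A.det ≠ 0 := fun A => by
    rw [GLset, Set.mem_ofPred_eq, Matrix.isUnit_iff_isUnit_det, isUnit_iff_ne_zero]
  ext B
  constructor
  · rintro ⟨A, hA, rfl⟩
    rw [hmem] at hA ⊢
    intro h
    have := det_map_eq_zero he' (A := e A) h
    rw [e.symm_apply_apply] at this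
    exact hA this
  · intro hB
    rw [hmem] at hB
    refine ⟨e.symm B, (hmem _).mpr fun h => hB ?_, ?_⟩
    · simpa using det_map_eq_zero he h
    · rw [← heφ, e.apply_symm_apply]
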